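/- A \emph{size pair} $(M,\varphi)$ consists of a non-empty compact, connected and locally connected Hausdorff space $M$ and a continuous function $\varphi:M\to\mathbb R$. Its \emph{size function} $\ell_{(M,\varphi)}$ assigns to each $(x,y)\in\mathbb R^2$ with $x<y$ the number of classes into which $\{\varphi\le x\}$ is divided by the relation of lying in the same connected component of $\{\varphi\le y\}$; this number is finite. Let $\ell$ be a size function. The \emph{multiplicity} of a point $(x,y)$ with $x<y$ is $$\mu(x,y)=\min\{\ell(x+\varepsilon,y-\varepsilon)-\ell(x-\varepsilon,y-\varepsilon)-\ell(x+\varepsilon,y+\varepsilon)+\ell(x-\varepsilon,y+\varepsilon)\;:\;\varepsilon>0,\ x+\varepsilon<y-\varepsilon\},$$ and $(x,y)$ is a \emph{proper cornerpoint} of $\ell$ if $\mu(x,y)>0$. The pair $(k,\infty)$, $k\in\mathbb R$, is a \emph{cornerpoint at infinity} of $\ell$ if $$\min\{\ell(k+\varepsilon,1/\varepsilon)-\ell(k-\varepsilon,1/\varepsilon)\;:\;\varepsilon>0,\ k+\varepsilon<1/\varepsilon\}>0;$$ there is exactly one such $k$. A \emph{representative sequence} of $\ell$ is a sequence $(a_n)_{n\in\mathbb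 N}$, $\mathbb N=\{0,1,2,\dots\}$, such that $a_0$ is the cornerpoint at infinity of $\ell$; each $a_n$ with $n>0$ is either a proper cornerpoint of $\ell$ or a point of the diagonal $\{(x,x):x\in\mathbb R\}$; each proper cornerpoint $(x,y)$ equals $a_n$ for exactly $\mu(x,y)$ indices $n$; and $a_n$ lies on the diagonal for infinitely many $n$. For points $(x,y)$, $(x',y')$ with $x,x'\in\mathbb R$, $y,y'\in\mathbb R\cup\{\infty\}$, $x\le y$, $x'\le y'$ put $$d((x,y),(x',y'))=\min\Big\{\max\{|x-x'|,|y-y'|\},\ \max\Big\{\frac{y-x}2,\frac{y'-x'}2\Big\}\Big\}\in[0,\infty],$$ with the conventions $\infty-\infty=0$, $\infty-y=y-\infty=\infty$ for $y\ne\infty$, $|\infty|=\infty/2=\infty$. The \emph{matching distance} of size functions $\ell_1,\ell_2$ with representative sequences $(a_n)$, $(b_n)$ is $$d_{match}(\ell_1,\ell_2)=\inf_\sigma\sup_n d(a_n,b_{\sigma(n)}),$$ where $\sigma$ runs over all bijections $\mathbb N\to\mathbb N$. Representative sequences exist, and the value does not depend on their choice. For size pairs $(M,\varphi)$ and $(N,\psi)$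 put $$\delta_\Lambda((M,\varphi),(N,\psi))=\inf_{h}\Big(\max_{M}(\varphi-\psi\circ h)-\min_{M}(\varphi-\psi\circ h)\Big),$$ where $h$ runs over all homeomorphisms $M\to N$ (and the value is $\infty$ if there are none). \textbf{Theorem.} Let $(M,\varphi)$ and $(N,\psi)$ be size pairs such that $M$ and $N$ are homeomorphic. Define $\Phi:M\times M\to\mathbb R$ and $\Psi:N\times N\to\mathbb R$ by $\Phi(p,q)=\varphi(p)-\varphi(q)$ and $\Psi(p,q)=\psi(p)-\psi(q)$. Then $$d_{match}(\ell_{(M\times M,\Phi)},\ell_{(N\times N,\Psi)})\le\delta_\Lambda((M,\varphi),(N,\psi)).$$ -/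

import Mathlib

open scoped ENNReal

namespace SizeTheory

/-- The lower level set of `φ` at level `y`. -/
def lowerLevel {M : Type*} [TopologicalSpace M] (φ : C(M, ℝ)) (y : ℝ) : Set M :=
  {p | φ p ≤ y}

/-- The relation of `⟨φ ≤ y⟩`-connectedness on the lower level set `⟨φ ≤ x⟩`: two points are
related when they have the same connected component in `⟨φ ≤ y⟩`. It is meant for `x < y`, so that
both points lie in `⟨φ ≤ y⟩`. -/
def levelSetoid {M : Type*} [TopologicalSpace M] (φ : C(M, ℝ)) (x y : ℝ) :
    Setoid (lowerLevel φ x) :=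
  Setoid.ker fun p => connectedComponentIn (lowerLevel φ y) (p : M)

/-- The size function of `(M, φ)`: the number of classes into which `⟨φ ≤ x⟩` is divided by
`⟨φ ≤ y⟩`-connectedness. Only its values at `x < y` are meaningful, and only these are used. -/
noncomputable def sizeFunction {M : Type*} [TopologicalSpace M] (φ : C(M, ℝ)) (x y : ℝ) : ℕ :=
  Nat.card (Quotient (levelSetoid φ x y))

/-- The multiplicity of a point `(x, y)`, `x < y`, for `ℓ`: the minimum, over the admissible `ε`,
of the alternating sum `μ_ε(x, y)`. -/
noncomputable def pointMultiplicity (ℓ : ℝ → ℝ → ℕ) (x y : ℝ) : ℤ :=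
  sInf {m : ℤ | ∃ ε : ℝ, 0 < ε ∧ x + ε < y - ε ∧
    m = (ℓ (x + ε) (y - ε) : ℤ) - ℓ (x - ε) (y - ε) - ℓ (x + ε) (y + ε) + ℓ (x - ε) (y + ε)}

/-- The multiplicity of the vertical line through `k` for `ℓ`. -/
noncomputable def multiplicityAtInfinity (ℓ : ℝ → ℝ → ℕ) (k : ℝ) : ℤ :=
  sInf {m : ℤ | ∃ ε : ℝ, 0 < ε ∧ k + ε < 1 / ε ∧
    m = (ℓ (k + ε) (1 / ε) : ℤ) - ℓ (k - ε) (1 / ε)}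

/-- The closed half-plane `x ≤ y`, extended by the points at infinity `(k, ∞)`. -/
inductive ExtendedHalfPlane : Type
  | point (x y : ℝ) (h : x ≤ y) : ExtendedHalfPlane
  | atInfinity (k : ℝ) : ExtendedHalfPlane

namespace ExtendedHalfPlane

/-- The pseudodistance
`min (max |x - x'| |y - y'|) (max ((y - x) / 2) ((y' - x') / 2))`, which by the conventions
`∞ - ∞ = 0`, `∞ - y = y - ∞ = ∞`, `∞ / 2 = ∞` is `|k - k'|` for two points at infinity, and `∞` for
a point at infinity and a point of the plane. -/
noncomputable def dist : ExtendedHalfPlane → ExtendedHalfPlane → ℝ≥0∞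
  | point x y _, point x' y' _ =>
      ENNReal.ofReal (min (max |x - x'| |y - y'|) (max ((y - x) / 2) ((y' - x') / 2)))
  | atInfinity k, atInfinity k' => ENNReal.ofReal |k - k'|
  | point _ _ _, atInfinity _ => ⊤
  | atInfinity _, point _ _ _ => ⊤

end ExtendedHalfPlane

open ExtendedHalfPlane in
/-- Representative sequences of a size function `ℓ`. -/
structure IsRepresentativeSequence (ℓ : ℝ → ℝ → ℕ) (a : ℕ → ExtendedHalfPlane) : Prop where
  /-- The term `a 0` is the cornerpoint at infinity. -/
  zero : ∃ k : ℝ, a 0 = atInfinity k ∧ 0 < multiplicityAtInfinity ℓ k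
  /-- Every other term is a point of the diagonal or a proper cornerpoint. -/
  pos : ∀ n : ℕ, 0 < n → ∃ (x y : ℝ) (h : x ≤ y),
    a n = point x y h ∧ (x = y ∨ x < y ∧ 0 < pointMultiplicity ℓ x y)
  /-- Every proper cornerpoint is repeated according to its multiplicity. -/
  count : ∀ (x y : ℝ) (h : x < y), 0 < pointMultiplicity ℓ x y →
    ({n : ℕ | a n = point x y h.le}.ncard : ℤ) = pointMultiplicity ℓ x y
  /-- Infinitely many terms lie on the diagonal. -/
  diagonal : {n : ℕ | ∃ x : ℝ, a n = point x x le_rfl}.Infinite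

open Classical in
/-- The matching distance between two size functions: the value of `inf_σ sup_n d (a n) (b (σ n))`
for representative sequences `a`, `b`. The value does not depend on the choice of `a` and `b`; an
upper bound for the supremum below is an upper bound for every choice. The value is `∞` if
representative sequences do not exist, which never happens for size functions of size pairs. -/
noncomputable def matchingDistance (ℓ₁ ℓ₂ : ℝ → ℝ → ℕ) : ℝ≥0∞ :=
  if (∃ a, IsRepresentativeSequence ℓ₁ a) ∧ (∃ b, IsRepresentativeSequence ℓ₂ b) then
    ⨆ (a : ℕ → ExtendedHalfPlane) (_ : IsRepresentativeSequence ℓ₁ a)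
      (b : ℕ → ExtendedHalfPlane) (_ : IsRepresentativeSequence ℓ₂ b),
      ⨅ σ : Equiv.Perm ℕ, ⨆ n : ℕ, (a n).dist (b (σ n))
  else ⊤

/-- The seminorm `max ξ - min ξ` on `C(M, ℝ)` for a nonempty compact space `M`. -/
noncomputable def oscillation {M : Type*} [TopologicalSpace M] (ξ : C(M, ℝ)) : ℝ :=
  (⨆ p, ξ p) - ⨅ p, ξ p

/-- The exotic pseudodistance of the seminorm `max - min`: the infimum of
`max (φ - ψ ∘ h) - min (φ - ψ ∘ h)` over all homeomorphisms `h : M → N`, and `∞` if there are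
none. -/
noncomputable def deltaLambda {M N : Type*} [TopologicalSpace M] [TopologicalSpace N]
    (φ : C(M, ℝ)) (ψ : C(N, ℝ)) : ℝ≥0∞ :=
  ⨅ h : M ≃ₜ N, ENNReal.ofReal (oscillation (φ - ψ.comp (h : C(M, N))))

/-- The measuring function `(p, q) ↦ φ p - φ q` on the product `M × M`. -/
def differenceFunction {M : Type*} [TopologicalSpace M] (φ : C(M, ℝ)) : C(M × M, ℝ) :=
  φ.comp ContinuousMap.fst - φ.comp ContinuousMap.snd

end SizeTheory

namespace SizeTheory

open Filter Topology Set

/-! ### Monotone integer-valued functions near a point -/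

/-! For a homeomorphism h put ξ = φ - ψ ∘ h. Pulled back along h × h, the function Ψ differs from Φ
at (p, q) by ξ(p) - ξ(q), which is at most max ξ - min ξ in absolute value. Size functions are
invariant under homeomorphisms, so everything reduces to stability, `matchingDistance_le`: measuring
functions at uniform distance at most c have size functions at matching distance at most c.

Stability comes from an induced matching. The level sets F_x of f and G_x of g satisfy F_x ⊆ G_{x+c}
⊆ F_{x+2c}. Between the two size functions stands the count m(x, y) of components of G_{y+c} that
meet F_x. Replacing F_y by G_{y+c} alters only the ambient set, hence only deaths; replacing F_x by
G_{x+c} alters only births. The inequalities are those of `componentCount_sub_le`. On each vertical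
line the j-th highest points of the two diagrams are paired, which lowers deaths by at most 2c;
duality gives the same for births. Both displacements are one-sided, so a diagonal shift by c leaves
an error of at most c in each coordinate (`exists_matching`).

Points of persistence at most 2c may stay unmatched and go to the diagonal at cost at most c. The
injections obtained in both directions are merged by a Schröder–Bernstein argument. Existence of
representative sequences rests on the countability of the set of births, `countable_birth`. -/

theorem eventually_eq_sInf_image {F : ℝ → ℤ} {δ : ℝ} (hδ : 0 < δ)
    (hmono : ∀ s t, 0 < s → s ≤ t → t < δ → F s ≤ F t)
    (hnonneg : ∀ t, 0 < t → t < δ → 0 ≤ F t) :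
    ∃ t₀, 0 < t₀ ∧ t₀ < δ ∧ ∀ t, 0 < t → t ≤ t₀ → F t = sInf (F '' Ioo 0 δ) := by
  have hne : (F '' Ioo 0 δ).Nonempty := (nonempty_Ioo.2 hδ).image F
  have hbdd : BddBelow (F '' Ioo 0 δ) := ⟨0, by
    rintro _ ⟨t, ht, rfl⟩
    exact hnonneg t ht.1 ht.2⟩
  -- A set of integers bounded below attains its infimum; monotonicity then forces the same value at
  -- all smaller parameters.
  obtain ⟨t₀, ht₀, h⟩ := Int.csInf_mem hne hbdd
  refine ⟨t₀, ht₀.1, ht₀.2, fun t ht htt => le_antisymm ?_ ?_⟩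
  · exact h ▸ hmono t t₀ ht htt ht₀.2
  · exact csInf_le hbdd ⟨t, ⟨ht, htt.trans_lt ht₀.2⟩, rfl⟩

/-! ### Rank functions -/

/-- The alternating sum of `r` over the corners of the rectangle `[x₁, x₂] × [y₁, y₂]`. -/
def boxCount (r : ℝ → ℝ → ℤ) (x₁ x₂ y₁ y₂ : ℝ) : ℤ :=
  r x₂ y₁ - r x₁ y₁ - r x₂ y₂ + r x₁ y₂

/-- A function on the half-plane `x < y` whose alternating sums over rectangles are nonnegative,
and vanish over the rectangles to the left of `-R` or above `R`. -/
structure IsRankFunction (R : ℝ) (r : ℝ → ℝ → ℤ) : Prop where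
  nonneg : ∀ {x₁ x₂ y₁ y₂}, x₁ ≤ x₂ → x₂ < y₁ → y₁ ≤ y₂ → 0 ≤ boxCount r x₁ x₂ y₁ y₂
  left : ∀ {x₁ x₂ y₁ y₂}, x₁ ≤ x₂ → x₂ < y₁ → y₁ ≤ y₂ → x₂ ≤ -R → boxCount r x₁ x₂ y₁ y₂ = 0
  above : ∀ {x₁ x₂ y₁ y₂}, x₁ ≤ x₂ → x₂ < y₁ → y₁ ≤ y₂ → R ≤ y₁ → boxCount r x₁ x₂ y₁ y₂ = 0

/-- The multiplicity of the point `(x, y)` for `r`. -/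
noncomputable def multiplicity (r : ℝ → ℝ → ℤ) (x y : ℝ) : ℤ :=
  sInf ((fun ε => boxCount r (x - ε) (x + ε) (y - ε) (y + ε)) '' Ioo 0 ((y - x) / 2))

/-- The rank function obtained by exchanging the roles of births and deaths. -/
def dualRank (r : ℝ → ℝ → ℤ) (x y : ℝ) : ℤ := r (-y) (-x)

/-- The number of points of `r` on the vertical line through `b` which lie above the level `y`. -/
noncomputable def birthCount (R : ℝ) (r : ℝ → ℝ → ℤ) (b y : ℝ) : ℤ :=
  sInf ((fun ε => boxCount r (b - ε) (b + ε) y (max y R)) '' Ioo 0 (y - b))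

/-- The point `(b, d)` is the `j`-th point, counted from above and starting from `0`, of `r` on
the vertical line through `b`. -/
def IsDeath (R : ℝ) (r : ℝ → ℝ → ℤ) (b : ℝ) (j : ℕ) (d : ℝ) : Prop :=
  b < d ∧ (∀ y, b < y → y < d → (j : ℤ) < birthCount R r b y) ∧
    ∀ y, d < y → birthCount R r b y ≤ j

theorem boxCount_dualRank (r : ℝ → ℝ → ℤ) (x₁ x₂ y₁ y₂ : ℝ) :
    boxCount (dualRank r) x₁ x₂ y₁ y₂ = boxCount r (-y₂) (-y₁) (-x₂) (-x₁) := by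
  simp only [boxCount, dualRank]; ring

theorem multiplicity_dualRank (r : ℝ → ℝ → ℤ) (x y : ℝ) :
    multiplicity (dualRank r) (-y) (-x) = multiplicity r x y := by
  unfold multiplicity
  simp only [boxCount_dualRank]
  have h : (-x - -y) / 2 = (y - x) / 2 := by ring
  rw [h]
  congr 2
  funext ε
  congr 1 <;> ring

theorem multiplicity_shift (r : ℝ → ℝ → ℤ) (c x y : ℝ) :
    multiplicity (fun x y => r (x + c) (y + c)) x y = multiplicity r (x + c) (y + c) := by
  unfold multiplicity boxCount
  have h : (y + c - (x + c)) / 2 = (y - x) / 2 := by ring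
  rw [h]
  congr 2
  funext ε
  have e₁ : x + ε + c = x + c + ε := by ring
  have e₂ : x - ε + c = x + c - ε := by ring
  have e₃ : y + ε + c = y + c + ε := by ring
  have e₄ : y - ε + c = y + c - ε := by ring
  simp only [e₁, e₂, e₃, e₄]

namespace IsRankFunction

variable {R : ℝ} {r : ℝ → ℝ → ℤ}

theorem dual (h : IsRankFunction R r) : IsRankFunction R (dualRank r) where
  nonneg h₁ h₂ h₃ := by
    rw [boxCount_dualRank]; exact h.nonneg (by linarith) (by linarith) (by linarith)
  left h₁ h₂ h₃ h₄ := by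
    rw [boxCount_dualRank]
    exact h.above (by linarith) (by linarith) (by linarith) (by linarith)
  above h₁ h₂ h₃ h₄ := by
    rw [boxCount_dualRank]
    exact h.left (by linarith) (by linarith) (by linarith) (by linarith)

/-- Box counts are additive: the large box splits into the small one, the full-height strips to its
left and right, and the pieces below and above it. -/
theorem boxCount_mono (h : IsRankFunction R r) {x₁ x₂ y₁ y₂ x₁' x₂' y₁' y₂' : ℝ}
    (hx : x₁ ≤ x₂) (hx₁ : x₁' ≤ x₁) (hx₂ : x₂ ≤ x₂') (hxy : x₂' < y₁') (hy₁ : y₁' ≤ y₁)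
    (hy : y₁ ≤ y₂) (hy₂ : y₂ ≤ y₂') : boxCount r x₁ x₂ y₁ y₂ ≤ boxCount r x₁' x₂' y₁' y₂' := by
  have e₁ := h.nonneg (x₁ := x₁') (x₂ := x₁) (y₁ := y₁') (y₂ := y₂') hx₁ (by linarith)
    (by linarith)
  have e₂ := h.nonneg (x₁ := x₂) (x₂ := x₂') (y₁ := y₁') (y₂ := y₂') hx₂ (by linarith)
    (by linarith)
  have e₃ := h.nonneg (x₁ := x₁) (x₂ := x₂) (y₁ := y₁') (y₂ := y₁) hx (by linarith) hy₁
  have e₄ := h.nonneg (x₁ := x₁) (x₂ := x₂) (y₁ := y₂) (y₂ := y₂') hx (by linarith) hy₂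
  unfold boxCount at *
  linarith

theorem boxCount_top (h : IsRankFunction R r) {x₁ x₂ y H : ℝ} (hx : x₁ ≤ x₂) (hxy : x₂ < y)
    (hH : max y R ≤ H) : boxCount r x₁ x₂ y (max y R) = boxCount r x₁ x₂ y H := by
  have e := h.above (x₁ := x₁) (x₂ := x₂) (y₁ := max y R) (y₂ := H) hx
    (hxy.trans_le (le_max_left _ _)) hH (le_max_right _ _)
  unfold boxCount at *
  linarith

/-- The threshold `t₀` does not depend on the top edge `H`, so counts at different levels can be
compared on one thin strip with one common top. -/
theorem birthCount_spec (h : IsRankFunction R r) {b y : ℝ} (hb : b < y) :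
    ∃ t₀, 0 < t₀ ∧ t₀ < y - b ∧ ∀ t, 0 < t → t ≤ t₀ → ∀ H, max y R ≤ H →
      boxCount r (b - t) (b + t) y H = birthCount R r b y := by
  obtain ⟨t₀, h₀, h₁, h₂⟩ := eventually_eq_sInf_image
    (F := fun ε => boxCount r (b - ε) (b + ε) y (max y R)) (δ := y - b) (by linarith)
    (fun s t hs hst ht => h.boxCount_mono (by linarith) (by linarith) (by linarith) (by linarith)
      le_rfl (le_max_left _ _) le_rfl)
    (fun t h₀ ht => h.nonneg (by linarith) (by linarith) (le_max_left _ _))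
  refine ⟨t₀, h₀, h₁, fun t ht htt H hH => ?_⟩
  rw [← h.boxCount_top (by linarith) (by linarith) hH]
  exact h₂ t ht htt

theorem birthCount_antitone (h : IsRankFunction R r) {b y z : ℝ} (hb : b < y) (hyz : y ≤ z) :
    birthCount R r b z ≤ birthCount R r b y := by
  obtain ⟨s, s₀, s₁, hs⟩ := h.birthCount_spec hb
  obtain ⟨t, t₀, t₁, ht⟩ := h.birthCount_spec (hb.trans_le hyz)
  have hm : 0 < min s t := lt_min s₀ t₀
  have := min_le_left s t
  have hH : max y R ≤ max z R := max_le_max hyz le_rfl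
  rw [← hs _ hm (min_le_left _ _) _ hH, ← ht _ hm (min_le_right _ _) _ le_rfl]
  exact h.boxCount_mono (by linarith) le_rfl le_rfl (by linarith) hyz (le_max_left _ _) le_rfl

theorem birthCount_nonneg (h : IsRankFunction R r) {b y : ℝ} (hb : b < y) :
    0 ≤ birthCount R r b y := by
  obtain ⟨s, s₀, s₁, hs⟩ := h.birthCount_spec hb
  rw [← hs s s₀ le_rfl _ le_rfl]
  exact h.nonneg (by linarith) (by linarith) (le_max_left _ _)

theorem birthCount_eq_zero (h : IsRankFunction R r) {b y : ℝ} (hb : b < y) (hy : R ≤ y) :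
    birthCount R r b y = 0 := by
  obtain ⟨s, s₀, s₁, hs⟩ := h.birthCount_spec hb
  rw [← hs s s₀ le_rfl _ le_rfl]
  exact h.above (by linarith) (by linarith) (le_max_left _ _) hy

theorem multiplicity_spec (h : IsRankFunction R r) {b d : ℝ} (hbd : b < d) :
    ∃ t₀, 0 < t₀ ∧ t₀ < (d - b) / 2 ∧ ∀ t, 0 < t → t ≤ t₀ →
      boxCount r (b - t) (b + t) (d - t) (d + t) = multiplicity r b d :=
  eventually_eq_sInf_image
    (F := fun ε => boxCount r (b - ε) (b + ε) (d - ε) (d + ε)) (δ := (d - b) / 2) (by linarith)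
    (fun s t hs hst ht => h.boxCount_mono (by linarith) (by linarith) (by linarith) (by linarith)
      (by linarith) (by linarith) (by linarith))
    (fun t h₀ ht => h.nonneg (by linarith) (by linarith) (by linarith))

theorem multiplicity_nonneg (h : IsRankFunction R r) {b d : ℝ} (hbd : b < d) :
    0 ≤ multiplicity r b d := by
  obtain ⟨s, s₀, s₁, hs⟩ := h.multiplicity_spec hbd
  rw [← hs s s₀ le_rfl]
  exact h.nonneg (by linarith) (by linarith) (by linarith)

/-- The multiplicity of `(b, d)` is the jump at `d` of the number of points above a level. -/
theorem birthCount_sub_birthCount (h : IsRankFunction R r) {b d : ℝ} (hbd : b < d) :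
    ∃ t₀, 0 < t₀ ∧ t₀ < (d - b) / 2 ∧ ∀ t, 0 < t → t ≤ t₀ →
      birthCount R r b (d - t) - birthCount R r b (d + t) = multiplicity r b d := by
  obtain ⟨t₀, h₀, h₁, h₂⟩ := h.multiplicity_spec hbd
  refine ⟨t₀, h₀, h₁, fun t ht htt => ?_⟩
  obtain ⟨s, s₀, s₁, hs⟩ := h.birthCount_spec (b := b) (y := d - t) (by linarith)
  obtain ⟨s', s₀', s₁', hs'⟩ := h.birthCount_spec (b := b) (y := d + t) (by linarith)
  obtain ⟨u, hu, hus, hus', hut⟩ : ∃ u, 0 < u ∧ u ≤ s ∧ u ≤ s' ∧ u ≤ t :=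
    ⟨min s (min s' t), by positivity, min_le_left _ _, (min_le_right _ _).trans (min_le_left _ _),
      (min_le_right _ _).trans (min_le_right _ _)⟩
  have hH : max (d - t) R ≤ max (d + t) R := max_le_max (by linarith) le_rfl
  rw [← hs u hu hus _ hH, ← hs' u hu hus' _ le_rfl]
  -- With a common top edge the two strips differ exactly by the box around `(b, d)`.
  have e : boxCount r (b - u) (b + u) (d - t) (max (d + t) R)
      - boxCount r (b - u) (b + u) (d + t) (max (d + t) R)
      = boxCount r (b - u) (b + u) (d - t) (d + t) := by
    unfold boxCount; ring
  rw [e]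
  apply le_antisymm
  · rw [← h₂ t ht htt]
    exact h.boxCount_mono (by linarith) (by linarith) (by linarith) (by linarith) le_rfl
      (by linarith) le_rfl
  · rw [← h₂ u hu (hut.trans htt)]
    exact h.boxCount_mono (by linarith) le_rfl le_rfl (by linarith) (by linarith) (by linarith)
      (by linarith)

/-- The indices dying at `d` form the integer interval from the count just above `d` (included) to
the count just below `d` (excluded), whose length is the jump. -/
theorem setOf_isDeath (h : IsRankFunction R r) {b d : ℝ} (hbd : b < d) :
    {j | IsDeath R r b j d}.Finite ∧ ({j | IsDeath R r b j d}.ncard : ℤ) = multiplicity r b d := by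
  obtain ⟨t₀, h₀, h₁, h₂⟩ := h.birthCount_sub_birthCount hbd
  have key : ∀ t, 0 < t → t ≤ t₀ → birthCount R r b (d - t) = birthCount R r b (d - t₀) ∧
      birthCount R r b (d + t) = birthCount R r b (d + t₀) := by
    intro t ht htt
    have e₁ := h₂ t ht htt
    have e₂ := h₂ t₀ h₀ le_rfl
    have e₃ := h.birthCount_antitone (b := b) (y := d - t₀) (z := d - t) (by linarith)
      (by linarith)
    have e₄ := h.birthCount_antitone (b := b) (y := d + t) (z := d + t₀) (by linarith)
      (by linarith)
    constructor <;> linarith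
  have hp := h.birthCount_nonneg (b := b) (y := d - t₀) (by linarith)
  have hq := h.birthCount_nonneg (b := b) (y := d + t₀) (by linarith)
  have e : {j | IsDeath R r b j d} = Finset.Ico (birthCount R r b (d + t₀)).toNat
      (birthCount R r b (d - t₀)).toNat := by
    ext j
    simp only [mem_ofPred_eq, Finset.coe_Ico, mem_Ico]
    constructor
    · rintro ⟨-, hj, hj'⟩
      have a₁ := hj (d - t₀) (by linarith) (by linarith)
      have a₂ := hj' (d + t₀) (by linarith)
      omega
    · rintro ⟨a₁, a₂⟩
      refine ⟨hbd, fun y hy hyd => ?_, fun y hy => ?_⟩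
      · have a₃ : birthCount R r b (d - t₀) ≤ birthCount R r b y := by
          rcases le_total y (d - t₀) with hle | hle
          · exact h.birthCount_antitone hy hle
          · have := (key (d - y) (by linarith) (by linarith)).1
            rw [sub_sub_cancel] at this
            exact this.ge
        omega
      · have a₃ : birthCount R r b y ≤ birthCount R r b (d + t₀) := by
          rcases le_total (d + t₀) y with hle | hle
          · exact h.birthCount_antitone (by linarith) hle
          · have := (key (y - d) (by linarith) (by linarith)).2
            rw [add_sub_cancel] at this
            exact this.le
        omega
  rw [e]
  refine ⟨Finset.finite_toSet _, ?_⟩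
  rw [Set.ncard_coe_finset, Nat.card_Ico, ← h₂ t₀ h₀ le_rfl]
  have := h.birthCount_antitone (b := b) (y := d - t₀) (z := d + t₀) (by linarith) (by linarith)
  omega

/-- The death is the supremum of the levels above which more than `j` points remain; these levels
are bounded by `R`. -/
theorem exists_isDeath (h : IsRankFunction R r) {b y : ℝ} {j : ℕ} (hb : b < y)
    (hj : (j : ℤ) < birthCount R r b y) : ∃ d, y ≤ d ∧ IsDeath R r b j d := by
  set S : Set ℝ := {z | b < z ∧ (j : ℤ) < birthCount R r b z} with hS
  have hyS : y ∈ S := ⟨hb, hj⟩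
  have hbdd : BddAbove S := ⟨R, fun z hz => by
    by_contra! hR
    have := h.birthCount_eq_zero hz.1 hR.le
    have := hz.2
    omega⟩
  refine ⟨sSup S, le_csSup hbdd hyS, hb.trans_le (le_csSup hbdd hyS), fun z hz hzS => ?_,
    fun z hz => ?_⟩
  · obtain ⟨w, hw, hzw⟩ := exists_lt_of_lt_csSup ⟨y, hyS⟩ hzS
    exact hw.2.trans_le (h.birthCount_antitone hz hzw.le)
  · by_contra! hlt
    exact hz.not_ge (le_csSup hbdd ⟨(hb.trans_le (le_csSup hbdd hyS)).trans hz, hlt⟩)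

end IsRankFunction

theorem IsDeath.unique {R : ℝ} {r : ℝ → ℝ → ℤ} {b d d' : ℝ} {j : ℕ} (h : IsDeath R r b j d)
    (h' : IsDeath R r b j d') : d = d' := by
  have key : ∀ {d d' : ℝ}, IsDeath R r b j d → IsDeath R r b j d' → d ≤ d' := by
    intro d d' h h'
    by_contra! hlt
    obtain ⟨y, h₁, h₂⟩ := exists_between hlt
    exact (h.2.1 y (h'.1.trans h₁) h₂).not_ge (h'.2.2 y h₁)
  exact le_antisymm (key h h') (key h' h)

/-! ### Interleaved births -/

/-- On every vertical strip the rank function `s` has fewer points above a level than `r`, and at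
least as many as `r` has above the level raised by `k`. -/
def Dominates (R : ℝ) (r s : ℝ → ℝ → ℤ) (k : ℝ) : Prop :=
  ∀ x₁ x₂ y H, x₁ ≤ x₂ → x₂ < y → R ≤ H →
    (y ≤ H → boxCount s x₁ x₂ y H ≤ boxCount r x₁ x₂ y H) ∧
    (y + k ≤ H → boxCount r x₁ x₂ (y + k) H ≤ boxCount s x₁ x₂ y H)

namespace Dominates

variable {R k : ℝ} {r s : ℝ → ℝ → ℤ}

theorem birthCount_le (H : Dominates R r s k) (hr : IsRankFunction R r) (hs : IsRankFunction R s)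
    {b y : ℝ} (hb : b < y) : birthCount R s b y ≤ birthCount R r b y := by
  obtain ⟨t, t₀, t₁, ht⟩ := hr.birthCount_spec hb
  obtain ⟨u, u₀, u₁, hu⟩ := hs.birthCount_spec hb
  have hm : 0 < min t u := lt_min t₀ u₀
  have := min_le_left t u
  rw [← ht _ hm (min_le_left _ _) _ le_rfl, ← hu _ hm (min_le_right _ _) _ le_rfl]
  exact (H _ _ _ _ (by linarith) (by linarith) (le_max_right _ _)).1 (le_max_left _ _)

theorem birthCount_add_le (H : Dominates R r s k) (hk : 0 ≤ k) (hr : IsRankFunction R r)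
    (hs : IsRankFunction R s) {b y : ℝ} (hb : b < y) :
    birthCount R r b (y + k) ≤ birthCount R s b y := by
  obtain ⟨t, t₀, t₁, ht⟩ := hr.birthCount_spec (b := b) (y := y + k) (by linarith)
  obtain ⟨u, u₀, u₁, hu⟩ := hs.birthCount_spec hb
  have hm : 0 < min t u := lt_min t₀ u₀
  have := min_le_right t u
  rw [← ht _ hm (min_le_left _ _) _ le_rfl,
    ← hu _ hm (min_le_right _ _) (max (y + k) R) (max_le_max (by linarith) le_rfl)]
  exact (H _ _ _ _ (by linarith) (by linarith) (le_max_right _ _)).2 (le_max_left _ _)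

/-- The `j`-th points on the same vertical line are paired. The two count inequalities sandwich the
death for `r` between `d` and `d + k`. -/
theorem exists_isDeath_left (H : Dominates R r s k) (hk : 0 ≤ k) (hr : IsRankFunction R r)
    (hs : IsRankFunction R s) {b d : ℝ} {j : ℕ} (h : IsDeath R s b j d) :
    ∃ d', IsDeath R r b j d' ∧ d ≤ d' ∧ d' ≤ d + k := by
  have h₁ : ∀ y, b < y → y < d → (j : ℤ) < birthCount R r b y := fun y hy hyd =>
    (h.2.1 y hy hyd).trans_le (H.birthCount_le hr hs hy)
  obtain ⟨y, hy, hyd⟩ := exists_between h.1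
  obtain ⟨d', hyd', hd'⟩ := hr.exists_isDeath hy (h₁ y hy hyd)
  refine ⟨d', hd', ?_, ?_⟩
  · by_contra! hlt
    obtain ⟨z, hz, hzd⟩ := exists_between hlt
    exact (h₁ z (hd'.1.trans hz) hzd).not_ge (hd'.2.2 z hz)
  · by_contra! hlt
    obtain ⟨z, hz, hzd⟩ := exists_between hlt
    have e₁ := hd'.2.1 z (by linarith [h.1]) hzd
    have e₂ := H.birthCount_add_le hk hr hs (b := b) (y := z - k) (by linarith [h.1])
    have e₃ := h.2.2 (z - k) (by linarith)
    rw [sub_add_cancel] at e₂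
    omega

/-- Persistence above `k` leaves a level `y - k` still above `b` at which `s` has more than `j`
points; the partner found there must lead back to `d` by uniqueness. -/
theorem exists_isDeath_right (H : Dominates R r s k) (hk : 0 ≤ k) (hr : IsRankFunction R r)
    (hs : IsRankFunction R s) {b d : ℝ} {j : ℕ} (h : IsDeath R r b j d) (hbd : b + k < d) :
    ∃ d', IsDeath R s b j d' ∧ d' ≤ d ∧ d ≤ d' + k := by
  obtain ⟨y, hy, hyd⟩ := exists_between hbd
  have hj : (j : ℤ) < birthCount R s b (y - k) := by
    have e₁ := h.2.1 y (by linarith) hyd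
    have e₂ := H.birthCount_add_le hk hr hs (b := b) (y := y - k) (by linarith)
    rw [sub_add_cancel] at e₂
    omega
  obtain ⟨d', -, hd'⟩ := hs.exists_isDeath (by linarith) hj
  obtain ⟨d'', hd'', h₁, h₂⟩ := H.exists_isDeath_left hk hr hs hd'
  obtain rfl := h.unique hd''
  exact ⟨d', hd', h₁, h₂⟩

end Dominates

/-! ### Enumerations of the points of a rank function -/

/-- The family `p` lists the points of `r` with their multiplicities. -/
structure Enumerates {ι : Type*} (r : ℝ → ℝ → ℤ) (p : ι → ℝ × ℝ) : Prop where
  lt : ∀ i, (p i).1 < (p i).2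
  finite : ∀ b d, b < d → {i | p i = (b, d)}.Finite
  ncard : ∀ b d, b < d → ({i | p i = (b, d)}.ncard : ℤ) = multiplicity r b d

/-- Fibres over a point above the diagonal are finite of equal cardinality, the others are empty;
fibrewise bijections glue. This permits switching between the indexing along vertical lines and the
one along horizontal lines. -/
theorem Enumerates.exists_equiv {ι κ : Type*} {r : ℝ → ℝ → ℤ} {p : ι → ℝ × ℝ} {q : κ → ℝ × ℝ}
    (hp : Enumerates r p) (hq : Enumerates r q) : ∃ e : ι ≃ κ, ∀ i, q (e i) = p i := by
  have key : ∀ c, Nonempty ({i // p i = c} ≃ {i // q i = c}) := by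
    rintro ⟨b, d⟩
    rcases lt_or_ge b d with h | h
    · have : Finite {i // p i = (b, d)} := hp.finite b d h
      have : Finite {i // q i = (b, d)} := hq.finite b d h
      refine Finite.card_eq.1 ?_
      have := (hp.ncard b d h).trans (hq.ncard b d h).symm
      exact_mod_cast this
    · have : IsEmpty {i // p i = (b, d)} := ⟨fun i => by
        have := hp.lt i
        rw [i.2] at this
        exact this.not_ge h⟩
      have : IsEmpty {i // q i = (b, d)} := ⟨fun i => by
        have := hq.lt i
        rw [i.2] at this
        exact this.not_ge h⟩
      exact ⟨Equiv.equivOfIsEmpty _ _⟩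
  exact ⟨Equiv.ofFiberEquiv fun c => (key c).some, fun i => Equiv.ofFiberEquiv_map _ i⟩

/-- A point of a rank function: a birth, an index, and a death. -/
structure RankPoint (R : ℝ) (r : ℝ → ℝ → ℤ) : Type where
  /-- The abscissa. -/
  birth : ℝ
  /-- The index on the vertical line. -/
  index : ℕ
  /-- The ordinate. -/
  death : ℝ
  isDeath : IsDeath R r birth index death

/-- The point of the plane that underlies a point of a rank function. -/
def RankPoint.pos {R : ℝ} {r : ℝ → ℝ → ℤ} (t : RankPoint R r) : ℝ × ℝ := (t.birth, t.death)

/-- Makes every map that preserves birth and index injective. -/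
theorem RankPoint.eq_of_birth_of_index {R : ℝ} {r : ℝ → ℝ → ℤ} {t t' : RankPoint R r}
    (h₁ : t.birth = t'.birth) (h₂ : t.index = t'.index) : t = t' := by
  obtain ⟨b, j, d, h⟩ := t
  obtain ⟨b', j', d', h'⟩ := t'
  obtain rfl : b = b' := h₁
  obtain rfl : j = j' := h₂
  obtain rfl : d = d' := h.unique h'
  rfl

theorem IsRankFunction.enumerates {R : ℝ} {r : ℝ → ℝ → ℤ} (h : IsRankFunction R r) :
    Enumerates r (RankPoint.pos : RankPoint R r → ℝ × ℝ) := by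
  have himage : ∀ b d : ℝ, RankPoint.index '' {t : RankPoint R r | t.pos = (b, d)} =
      {j | IsDeath R r b j d} := by
    intro b d
    ext j
    constructor
    · rintro ⟨⟨b', j', d', ht⟩, h₁, rfl⟩
      obtain ⟨rfl, rfl⟩ := Prod.mk.inj h₁
      exact ht
    · intro hj
      exact ⟨⟨b, j, d, hj⟩, rfl, rfl⟩
  have hinj : ∀ b d : ℝ, InjOn RankPoint.index {t : RankPoint R r | t.pos = (b, d)} := by
    intro b d t ht t' ht' e
    exact RankPoint.eq_of_birth_of_index
      ((congrArg Prod.fst ht).trans (congrArg Prod.fst ht').symm) e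
  refine ⟨fun t => t.isDeath.1, fun b d hbd => ?_, fun b d hbd => ?_⟩
  · refine Set.Finite.of_finite_image ?_ (hinj b d)
    rw [himage]
    exact (h.setOf_isDeath hbd).1
  · rw [← (h.setOf_isDeath hbd).2, ← himage, (hinj b d).ncard_image]

theorem Enumerates.of_dualRank {ι : Type*} {r : ℝ → ℝ → ℤ} {p : ι → ℝ × ℝ}
    (hp : Enumerates (dualRank r) p) : Enumerates r fun i => (-(p i).2, -(p i).1) := by
  have e : ∀ b d, {i | (-(p i).2, -(p i).1) = (b, d)} = {i | p i = (-d, -b)} := by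
    intro b d
    ext i
    simp only [mem_ofPred_eq, Prod.ext_iff, neg_eq_iff_eq_neg]
    exact and_comm
  refine ⟨fun i => neg_lt_neg (hp.lt i), fun b d h => ?_, fun b d h => ?_⟩
  · rw [e]; exact hp.finite _ _ (neg_lt_neg h)
  · rw [e, ← multiplicity_dualRank]; exact hp.ncard _ _ (neg_lt_neg h)

theorem Enumerates.shift {ι : Type*} {r : ℝ → ℝ → ℤ} {p : ι → ℝ × ℝ} {c : ℝ}
    (hp : Enumerates (fun x y => r (x + c) (y + c)) p) :
    Enumerates r fun i => ((p i).1 + c, (p i).2 + c) := by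
  have e : ∀ b d, {i | ((p i).1 + c, (p i).2 + c) = (b, d)} = {i | p i = (b - c, d - c)} := by
    intro b d
    ext i
    simp only [mem_ofPred_eq, Prod.ext_iff, eq_sub_iff_add_eq]
  refine ⟨fun i => ?_, fun b d h => ?_, fun b d h => ?_⟩
  · have := hp.lt i
    simpa using this
  · rw [e]; exact hp.finite _ _ (by linarith)
  · rw [e, hp.ncard _ _ (by linarith), multiplicity_shift, sub_add_cancel, sub_add_cancel]

theorem Dominates.exists_injection_left {R k : ℝ} {r s : ℝ → ℝ → ℤ} (H : Dominates R r s k)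
    (hk : 0 ≤ k) (hr : IsRankFunction R r) (hs : IsRankFunction R s) :
    ∃ f : RankPoint R s → RankPoint R r, Function.Injective f ∧ ∀ t,
      (f t).pos.1 = t.pos.1 ∧ t.pos.2 ≤ (f t).pos.2 ∧ (f t).pos.2 ≤ t.pos.2 + k := by
  choose d hd h₁ h₂ using fun t : RankPoint R s => H.exists_isDeath_left hk hr hs t.isDeath
  refine ⟨fun t => ⟨t.birth, t.index, d t, hd t⟩, fun t t' h => ?_, fun t => ⟨rfl, h₁ t, h₂ t⟩⟩
  exact RankPoint.eq_of_birth_of_index (RankPoint.mk.inj h).1 (RankPoint.mk.inj h).2.1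

theorem Dominates.exists_injection_right {R k : ℝ} {r s : ℝ → ℝ → ℤ} (H : Dominates R r s k)
    (hk : 0 ≤ k) (hr : IsRankFunction R r) (hs : IsRankFunction R s) :
    ∃ f : {t : RankPoint R r // t.pos.1 + k < t.pos.2} → RankPoint R s,
      Function.Injective f ∧ ∀ t,
      (f t).pos.1 = t.1.pos.1 ∧ (f t).pos.2 ≤ t.1.pos.2 ∧ t.1.pos.2 ≤ (f t).pos.2 + k := by
  choose d hd h₁ h₂ using fun t : {t : RankPoint R r // t.pos.1 + k < t.pos.2} =>
    H.exists_isDeath_right hk hr hs t.1.isDeath t.2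
  refine ⟨fun t => ⟨t.1.birth, t.1.index, d t, hd t⟩, fun t t' h => Subtype.ext ?_,
    fun t => ⟨rfl, h₁ t, h₂ t⟩⟩
  exact RankPoint.eq_of_birth_of_index (RankPoint.mk.inj h).1 (RankPoint.mk.inj h).2.1

/-- The induced matching: rank functions that are interleaved through a third one have matching
points. -/
theorem exists_matching {ι κ : Type*} {R c : ℝ} {r s m : ℝ → ℝ → ℤ} (hc : 0 ≤ c)
    (hr : IsRankFunction R r) (hm : IsRankFunction R m)
    (hs : IsRankFunction R fun x y => s (x + c) (y + c))
    (h₁ : Dominates R r m (2 * c))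
    (h₂ : Dominates R (dualRank fun x y => s (x + c) (y + c)) (dualRank m) (2 * c))
    {p : ι → ℝ × ℝ} {q : κ → ℝ × ℝ} (hp : Enumerates r p) (hq : Enumerates s q) :
    ∃ f : {i // (p i).1 + 2 * c < (p i).2} → κ, Function.Injective f ∧
      ∀ i, |(p i.1).1 - (q (f i)).1| ≤ c ∧ |(p i.1).2 - (q (f i)).2| ≤ c := by
  have hk : 0 ≤ 2 * c := by linarith
  obtain ⟨e₁, he₁⟩ := hp.exists_equiv hr.enumerates
  obtain ⟨f₁, hf₁, hf₁'⟩ := h₁.exists_injection_right hk hr hm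
  obtain ⟨e₂, he₂⟩ := hm.enumerates.exists_equiv hm.dual.enumerates.of_dualRank
  obtain ⟨f₂, hf₂, hf₂'⟩ := h₂.exists_injection_left hk hs.dual hm.dual
  obtain ⟨e₃, he₃⟩ := hs.dual.enumerates.of_dualRank.shift.exists_equiv hq
  -- `f₁` keeps births and lowers deaths by at most `2 * c`; `f₂`, acting on dual diagrams, keeps
  -- deaths and lowers births by at most `2 * c`; `e₃` adds `c` to both coordinates. Only `f₁` needs
  -- large persistence.
  refine ⟨fun i => e₃ (f₂ (e₂ (f₁ ⟨e₁ i, by rw [he₁]; exact i.2⟩))), fun i j hij => ?_,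
    fun i => ?_⟩
  · have := congrArg Subtype.val (hf₁ (e₂.injective (hf₂ (e₃.injective hij))))
    exact Subtype.ext (e₁.injective this)
  · have a₁ := hf₁' ⟨e₁ i, by rw [he₁]; exact i.2⟩
    have a₂ := he₂ (f₁ ⟨e₁ i, by rw [he₁]; exact i.2⟩)
    have a₃ := hf₂' (e₂ (f₁ ⟨e₁ i, by rw [he₁]; exact i.2⟩))
    simp only [he₁] at a₁
    rw [he₃]
    rw [← a₂] at a₁
    obtain ⟨b₁, b₂, b₃⟩ := a₁
    obtain ⟨b₄, b₅, b₆⟩ := a₃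
    constructor <;> rw [abs_le] <;> constructor <;> simp only at * <;> linarith

/-! ### Countability of the set of births -/

/-- Each birth is a discontinuity of one of countably many monotone functions of the right edge of a
box, indexed by rational pairs, and a monotone function has countably many discontinuities. -/
theorem IsRankFunction.countable_birth {R : ℝ} {r : ℝ → ℝ → ℤ} (h : IsRankFunction R r) :
    {b : ℝ | ∃ y, b < y ∧ 0 < birthCount R r b y}.Countable := by
  -- Clamping `x` to `[-R - 1, q]` makes the function monotone on the whole line. Births are at
  -- least `-R`, so the base `-R - 1` leaves room of length one on their left.
  set F : ℚ → ℚ → ℝ → ℝ := fun q q' x =>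
    (boxCount r (-R - 1) (max (-R - 1) (min x q)) q' (max q' R) : ℝ) with hF
  have hmono : ∀ q q' : ℚ, -R - 1 < (q : ℝ) → (q : ℝ) < q' → Monotone (F q q') := by
    intro q q' hR hqq x x' hx
    have : max (-R - 1) (min x q) ≤ max (-R - 1) (min x' q) :=
      max_le_max le_rfl (min_le_min hx le_rfl)
    have h₁ : max (-R - 1) (min x' (q : ℝ)) ≤ q := max_le hR.le (min_le_right _ _)
    exact Int.cast_le.2 (h.boxCount_mono (le_max_left _ _) le_rfl this (by linarith) le_rfl
      (le_max_left _ _) le_rfl)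
  have hcount : (⋃ (q : ℚ) (q' : ℚ) (_ : -R - 1 < (q : ℝ) ∧ (q : ℝ) < q'),
      {x | ¬ ContinuousAt (F q q') x}).Countable :=
    countable_iUnion fun q => countable_iUnion fun q' => countable_iUnion fun hq =>
      (hmono q q' hq.1 hq.2).countable_not_continuousAt
  refine hcount.mono ?_
  rintro b ⟨y, hb, hpos⟩
  have hbR : -R ≤ b := by
    by_contra! hlt
    obtain ⟨s, s₀, s₁, hs⟩ := h.birthCount_spec hb
    have hm : 0 < min s (-R - b) := lt_min s₀ (by linarith)
    have h₁ := min_le_left s (-R - b)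
    have h₂ := min_le_right s (-R - b)
    rw [← hs _ hm (min_le_left _ _) _ le_rfl,
      h.left (by linarith) (by linarith) (le_max_left _ _) (by linarith)] at hpos
    exact hpos.false
  obtain ⟨q, hq, hqy⟩ := exists_rat_btwn hb
  obtain ⟨q', hq', hqy'⟩ := exists_rat_btwn hqy
  have hpos' := hpos.trans_le (h.birthCount_antitone (hq.trans hq') hqy'.le)
  simp only [mem_iUnion, mem_ofPred_eq]
  refine ⟨q, q', ⟨by linarith, hq'⟩, fun hcont => ?_⟩
  obtain ⟨s, s₀, s₁, hs⟩ := h.birthCount_spec (hq.trans hq')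
  -- The jump is a positive integer, so two deviations below `1 / 2` contradict it.
  obtain ⟨δ, hδ, hcl⟩ := Metric.continuousAt_iff.1 hcont (1 / 2) (by norm_num)
  obtain ⟨t, ht, hts, htδ, htq, htR⟩ : ∃ t, 0 < t ∧ t ≤ s ∧ t < δ ∧ b + t ≤ q ∧ t ≤ 1 := by
    refine ⟨min (min s (δ / 2)) (min (q - b) 1), ?_, ?_, ?_, ?_, ?_⟩
    · exact lt_min (lt_min s₀ (by linarith)) (lt_min (by linarith) one_pos)
    · exact (min_le_left _ _).trans (min_le_left _ _)
    · exact ((min_le_left _ _).trans (min_le_right _ _)).trans_lt (by linarith)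
    · have := (min_le_right (min s (δ / 2)) (min (q - b) 1)).trans (min_le_left _ _)
      linarith
    · exact (min_le_right _ _).trans (min_le_right _ _)
  have c₁ := hcl (x := b - t) (by rw [Real.dist_eq, sub_sub_cancel_left, abs_neg, abs_of_pos ht]
                                  exact htδ)
  have c₂ := hcl (x := b + t) (by rw [Real.dist_eq, add_sub_cancel_left, abs_of_pos ht]
                                  exact htδ)
  have e₁ : max (-R - 1) (min (b - t) (q : ℝ)) = b - t := by
    rw [min_eq_left (by linarith), max_eq_right (by linarith)]
  have e₂ : max (-R - 1) (min (b + t) (q : ℝ)) = b + t := by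
    rw [min_eq_left (by linarith), max_eq_right (by linarith)]
  have e₃ := hs t ht hts _ le_rfl
  have e₄ : F q q' (b + t) - F q q' (b - t) = birthCount R r b q' := by
    rw [← e₃]
    simp only [hF, e₁, e₂]
    unfold boxCount
    push_cast
    ring
  have e₅ : (1 : ℝ) ≤ birthCount R r b q' := by exact_mod_cast hpos'
  rw [Real.dist_eq, abs_lt] at c₁ c₂
  linarith [c₁.1, c₂.2]

theorem IsRankFunction.countable_rankPoint {R : ℝ} {r : ℝ → ℝ → ℤ} (h : IsRankFunction R r) :
    Countable (RankPoint R r) := by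
  have : Countable {b : ℝ | ∃ y, b < y ∧ 0 < birthCount R r b y} := h.countable_birth.to_subtype
  let f : RankPoint R r → {b : ℝ | ∃ y, b < y ∧ 0 < birthCount R r b y} × ℕ := fun t =>
    (⟨t.birth, by
      obtain ⟨y, h₁, h₂⟩ := exists_between t.isDeath.1
      exact ⟨y, h₁, (Int.natCast_nonneg _).trans_lt (t.isDeath.2.1 y h₁ h₂)⟩⟩, t.index)
  have hf : Function.Injective f := fun t t' e =>
    RankPoint.eq_of_birth_of_index (congrArg (fun z => (z.1 : ℝ)) e) (congrArg Prod.snd e)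
  exact hf.countable

/-! ### Counting connected components -/

section Components

variable {X Y : Type*} [TopologicalSpace X] [TopologicalSpace Y]

/-- The number of connected components of `B` which meet `A`, for `A ⊆ B`. -/
noncomputable def componentCount (A B : Set X) : ℕ := (connectedComponentIn B '' A).ncard

theorem sizeFunction_eq_componentCount (f : C(X, ℝ)) (x y : ℝ) :
    sizeFunction f x y = componentCount (lowerLevel f x) (lowerLevel f y) := by
  rw [sizeFunction, componentCount, levelSetoid, Nat.card_congr (Setoid.quotientKerEquivRange _),
    ← Nat.card_coe_set_eq]
  congr 2
  ext C
  simp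

/-- By local connectedness the component in `B` of each point of `A` is a neighbourhood of that
point; finitely many such components cover the compact set `A`. -/
theorem finite_components [CompactSpace X] [LocallyConnectedSpace X] {A B O : Set X}
    (hA : IsClosed A) (hO : IsOpen O) (hAO : A ⊆ O) (hOB : O ⊆ B) :
    (connectedComponentIn B '' A).Finite := by
  obtain ⟨t, htA, ht⟩ := hA.isCompact.elim_nhds_subcover (connectedComponentIn B) fun p hp =>
    connectedComponentIn_mem_nhds (mem_of_superset (hO.mem_nhds (hAO hp)) hOB)
  refine (t.finite_toSet.image (connectedComponentIn B)).subset ?_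
  rintro _ ⟨p, hp, rfl⟩
  obtain ⟨q, hq, hpq⟩ := mem_iUnion₂.1 (ht hp)
  exact ⟨q, hq, connectedComponentIn_eq hpq⟩

theorem componentCount_mono {A₁ A₂ B : Set X} (hA : A₁ ⊆ A₂)
    (hfin : (connectedComponentIn B '' A₂).Finite) :
    componentCount A₁ B ≤ componentCount A₂ B :=
  ncard_le_ncard (image_mono hA) hfin

/-- Enlarging the ambient set decreases the number of components that meet the larger, but not
the smaller, of two sets. -/
theorem componentCount_sub_le {A₁ A₂ B₁ B₂ : Set X} (hA : A₁ ⊆ A₂) (hAB : A₂ ⊆ B₁) (hB : B₁ ⊆ B₂)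
    (h₁ : (connectedComponentIn B₁ '' A₂).Finite) (h₂ : (connectedComponentIn B₂ '' A₂).Finite) :
    (componentCount A₂ B₂ : ℤ) - componentCount A₁ B₂ ≤
      componentCount A₂ B₁ - componentCount A₁ B₁ := by
  have key : ∀ p ∈ B₁, ∀ q ∈ B₁, connectedComponentIn B₁ p = connectedComponentIn B₁ q →
      connectedComponentIn B₂ p = connectedComponentIn B₂ q := by
    intro p hp q hq h
    refine connectedComponentIn_eq (connectedComponentIn_mono _ hB ?_)
    rw [h]
    exact mem_connectedComponentIn hq
  have e : ∀ {B : Set X}, (connectedComponentIn B '' A₂).Finite →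
      (componentCount A₂ B : ℤ) - componentCount A₁ B =
        (connectedComponentIn B '' A₂ \ connectedComponentIn B '' A₁).ncard := by
    intro B hfin
    have := ncard_sdiff_add_ncard_of_subset (image_mono (f := connectedComponentIn B) hA) hfin
    unfold componentCount
    omega
  rw [e h₁, e h₂]
  -- Choose, for each component of `B₂` meeting `A₂`, a component of `B₁` meeting it in a point of
  -- `A₂`. A component of `B₁` determines the one of `B₂` containing it, so the choice is injective
  -- and still avoids `A₁`. The value `∅` elsewhere is a dummy.
  have hsurj : ∀ C : Set X, ∃ D, C ∈ connectedComponentIn B₂ '' A₂ →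
      ∃ p ∈ A₂, connectedComponentIn B₂ p = C ∧ connectedComponentIn B₁ p = D := by
    intro C
    by_cases hC : C ∈ connectedComponentIn B₂ '' A₂
    · obtain ⟨p, hp, hpC⟩ := hC
      exact ⟨_, fun _ => ⟨p, hp, hpC, rfl⟩⟩
    · exact ⟨∅, fun h => absurd h hC⟩
  choose g hg using hsurj
  have := ncard_le_ncard_of_injOn
    (s := connectedComponentIn B₂ '' A₂ \ connectedComponentIn B₂ '' A₁)
    (t := connectedComponentIn B₁ '' A₂ \ connectedComponentIn B₁ '' A₁) g ?_ ?_
    (h₁.subset sdiff_subset)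
  · exact_mod_cast this
  · intro C hC
    obtain ⟨p, hp, hpC, hpD⟩ := hg C hC.1
    refine ⟨⟨p, hp, hpD⟩, ?_⟩
    rintro ⟨q, hq, hqD⟩
    exact hC.2 ⟨q, hq, hpC ▸ key _ (hAB (hA hq)) _ (hAB hp) (hqD.trans hpD.symm)⟩
  · intro C hC C' hC' h
    obtain ⟨p, hp, hpC, hpD⟩ := hg C hC.1
    obtain ⟨q, hq, hqC, hqD⟩ := hg C' hC'.1
    rw [← hpC, ← hqC]
    exact key _ (hAB hp) _ (hAB hq) (hpD.trans (h.trans hqD.symm))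

theorem componentCount_univ [ConnectedSpace X] {A : Set X} (hA : A.Nonempty) :
    componentCount A univ = 1 := by
  have e : connectedComponentIn (univ : Set X) = fun _ => univ := by
    funext p
    rw [connectedComponentIn_univ, PreconnectedSpace.connectedComponent_eq_univ]
  rw [componentCount, e, hA.image_const, ncard_singleton]

theorem componentCount_empty (B : Set X) : componentCount ∅ B = 0 := by
  simp [componentCount]

theorem componentCount_preimage (h : X ≃ₜ Y) (A B : Set Y) :
    componentCount (h ⁻¹' A) (h ⁻¹' B) = componentCount A B := by
  have e : ∀ p, h '' connectedComponentIn (h ⁻¹' B) p = connectedComponentIn B (h p) := by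
    intro p
    by_cases hp : h p ∈ B
    · rw [h.image_connectedComponentIn hp, image_preimage_eq _ h.surjective]
    · rw [connectedComponentIn_eq_empty hp, connectedComponentIn_eq_empty (F := h ⁻¹' B) hp,
        image_empty]
  rw [componentCount, componentCount,
    ← ncard_image_of_injective _ (image_injective.2 h.injective), image_image]
  simp only [e]
  rw [← image_image (connectedComponentIn B) h, image_preimage_eq _ h.surjective]

theorem sizeFunction_comp_homeomorph (h : X ≃ₜ Y) (f : C(Y, ℝ)) :
    sizeFunction (f.comp (h : C(X, Y))) = sizeFunction f := by
  funext x y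
  rw [sizeFunction_eq_componentCount, sizeFunction_eq_componentCount,
    ← componentCount_preimage h]
  rfl

/-- The component counts of a filtration in another one form a rank function. -/
theorem isRankFunction_componentCount {R : ℝ} {U V : ℝ → Set X} (hU : Monotone U)
    (hV : Monotone V) (hUV : ∀ {x y}, x < y → U x ⊆ V y)
    (hfin : ∀ {x y}, x < y → (connectedComponentIn (V y) '' U x).Finite)
    (hempty : ∀ {x}, x ≤ -R → U x = ∅) (huniv : ∀ {y}, R ≤ y → V y = univ) :
    IsRankFunction R fun x y => (componentCount (U x) (V y) : ℤ) where
  nonneg hx hxy hy := by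
    have := componentCount_sub_le (hU hx) (hUV hxy) (hV hy) (hfin hxy) (hfin (hxy.trans_le hy))
    unfold boxCount
    linarith
  left hx hxy hy h := by
    unfold boxCount
    simp only [hempty h, hempty (hx.trans h), componentCount_empty]
    norm_num
  above hx hxy hy h := by
    unfold boxCount
    simp only [huniv h, huniv (h.trans hy)]
    ring

end Components

/-! ### Size functions of size pairs -/

/-- The properties of the size function of a size pair on which the existence of representative
sequences depends. Here `k` is the minimum of the measuring function. -/
structure IsSizeRank (k R : ℝ) (ℓ : ℝ → ℝ → ℕ) : Prop where
  isRankFunction : IsRankFunction R fun x y => (ℓ x y : ℤ)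
  mono : ∀ {x₁ x₂ y}, x₁ ≤ x₂ → x₂ < y → ℓ x₁ y ≤ ℓ x₂ y
  zero : ∀ {x y}, x < k → ℓ x y = 0
  one : ∀ {x y}, k ≤ x → R ≤ y → ℓ x y = 1
  pos : ∀ {x y}, k ≤ x → x < y → 0 < ℓ x y

section Levels

variable {X : Type*} [TopologicalSpace X]

theorem monotone_lowerLevel (f : C(X, ℝ)) : Monotone (lowerLevel f) :=
  fun _ _ hxy _ hp => le_trans (α := ℝ) hp hxy

theorem lowerLevel_subset {f g : C(X, ℝ)} {c x y : ℝ} (hfg : ∀ p, g p ≤ f p + c)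
    (hxy : x + c ≤ y) : lowerLevel f x ⊆ lowerLevel g y :=
  fun p hp => by
    have h₁ : f p ≤ x := hp
    exact (by linarith [hfg p] : g p ≤ y)

theorem lowerLevel_eq_univ {f : C(X, ℝ)} {B y : ℝ} (hf : ∀ p, |f p| ≤ B) (hy : B ≤ y) :
    lowerLevel f y = univ :=
  eq_univ_of_forall fun p => ((le_abs_self _).trans (hf p)).trans hy

theorem lowerLevel_eq_empty {f : C(X, ℝ)} {B x : ℝ} (hf : ∀ p, |f p| ≤ B) (hx : x < -B) :
    lowerLevel f x = ∅ := by
  refine eq_empty_of_forall_notMem fun p hp => ?_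
  have h₁ : f p ≤ x := hp
  linarith [neg_abs_le (f p), hf p]

variable [CompactSpace X] [LocallyConnectedSpace X]

/-- The strict inequality leaves room for the open set `{g < y}` between the two level sets. -/
theorem finite_components_lowerLevel {f g : C(X, ℝ)} {c x y : ℝ} (hfg : ∀ p, g p ≤ f p + c)
    (hxy : x + c < y) : (connectedComponentIn (lowerLevel g y) '' lowerLevel f x).Finite := by
  refine finite_components (O := {p | g p < y}) (isClosed_le f.continuous continuous_const)
    (isOpen_lt g.continuous continuous_const) (fun p hp => ?_) (fun p hp => le_of_lt (α := ℝ) hp)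
  have h₁ : f p ≤ x := hp
  exact (by linarith [hfg p] : g p < y)

/-- Size functions of uniformly close measuring functions have matching points. -/
theorem exists_matching_sizeFunction {ι κ : Type*} {f g : C(X, ℝ)} {c : ℝ} (hc : 0 ≤ c)
    (hfg : ∀ p, |f p - g p| ≤ c) {p : ι → ℝ × ℝ} {q : κ → ℝ × ℝ}
    (hp : Enumerates (fun x y => (sizeFunction f x y : ℤ)) p)
    (hq : Enumerates (fun x y => (sizeFunction g x y : ℤ)) q) :
    ∃ F : {i // (p i).1 + 2 * c < (p i).2} → κ, Function.Injective F ∧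
      ∀ i, |(p i.1).1 - (q (F i)).1| ≤ c ∧ |(p i.1).2 - (q (F i)).2| ≤ c := by
  obtain ⟨B₁, hB₁⟩ := isCompact_univ.exists_bound_of_continuousOn f.continuous.continuousOn
  obtain ⟨B₂, hB₂⟩ := isCompact_univ.exists_bound_of_continuousOn g.continuous.continuousOn
  set B := max B₁ B₂
  have hf : ∀ p, |f p| ≤ B := fun p => (hB₁ p (mem_univ p)).trans (le_max_left _ _)
  have hg : ∀ p, |g p| ≤ B := fun p => (hB₂ p (mem_univ p)).trans (le_max_right _ _)
  have hfg₁ : ∀ p, g p ≤ f p + c := fun p => by linarith [(abs_le.1 (hfg p)).1]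
  have hfg₂ : ∀ p, f p ≤ g p + c := fun p => by linarith [(abs_le.1 (hfg p)).2]
  have hff : ∀ p, f p ≤ f p + 0 := fun p => (add_zero _).ge
  have hgg : ∀ p, g p ≤ g p + 0 := fun p => (add_zero _).ge
  -- The margin `c` absorbs the shift of the levels of `g`; the extra `1` makes the level sets at
  -- `-R` strictly too low, hence empty.
  set R := B + c + 1 with hR
  have hgmono : Monotone fun x => lowerLevel g (x + c) := fun x y h =>
    monotone_lowerLevel g (by linarith)
  simp only [sizeFunction_eq_componentCount] at hp hq
  refine exists_matching (R := R)
    (r := fun x y => (componentCount (lowerLevel f x) (lowerLevel f y) : ℤ))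
    (s := fun x y => (componentCount (lowerLevel g x) (lowerLevel g y) : ℤ))
    (m := fun x y => (componentCount (lowerLevel f x) (lowerLevel g (y + c)) : ℤ))
    hc ?_ ?_ ?_ ?_ ?_ hp hq
  · exact isRankFunction_componentCount (monotone_lowerLevel f) (monotone_lowerLevel f)
      (fun h => monotone_lowerLevel f h.le)
      (fun h => finite_components_lowerLevel hff (by linarith))
      (fun h => lowerLevel_eq_empty hf (by linarith))
      fun h => lowerLevel_eq_univ hf (by linarith)
  · exact isRankFunction_componentCount (monotone_lowerLevel f) hgmono
      (fun h => lowerLevel_subset hfg₁ (by linarith))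
      (fun h => finite_components_lowerLevel hfg₁ (by linarith))
      (fun h => lowerLevel_eq_empty hf (by linarith))
      fun h => lowerLevel_eq_univ hg (by linarith)
  · exact isRankFunction_componentCount hgmono hgmono
      (fun h => hgmono h.le)
      (fun h => finite_components_lowerLevel hgg (by linarith))
      (fun h => lowerLevel_eq_empty hg (by linarith))
      fun h => lowerLevel_eq_univ hg (by linarith)
  · intro x₁ x₂ y H hx hxy hH
    -- At the top edge both ambient sets are the whole space, so the top terms agree; what remains
    -- is the effect of F_y ⊆ G_{y+c} ⊆ F_{y+2c} on the ambient set.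
    have e₁ : lowerLevel f H = univ := lowerLevel_eq_univ hf (by linarith)
    have e₂ : lowerLevel g (H + c) = univ := lowerLevel_eq_univ hg (by linarith)
    simp only [boxCount, e₁, e₂]
    constructor <;> intro _
    · have := componentCount_sub_le (monotone_lowerLevel f hx) (monotone_lowerLevel f hxy.le)
        (lowerLevel_subset (y := y + c) hfg₁ le_rfl)
        (finite_components_lowerLevel hff (by linarith))
        (finite_components_lowerLevel hfg₁ (by linarith))
      linarith
    · have := componentCount_sub_le (B₁ := lowerLevel g (y + c)) (B₂ := lowerLevel f (y + 2 * c))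
        (monotone_lowerLevel f hx) (lowerLevel_subset hfg₁ (by linarith))
        (lowerLevel_subset hfg₂ (by linarith))
        (finite_components_lowerLevel hfg₁ (by linarith))
        (finite_components_lowerLevel hff (by linarith))
      linarith
  · intro x₁ x₂ y H hx hxy hH
    -- Dually the top terms vanish, and each box counts the classes of one set lost when the ambient
    -- set grows. A larger set loses at least as many, by `componentCount_sub_le` rearranged.
    have e₁ : lowerLevel f (-H) = ∅ := lowerLevel_eq_empty hf (by linarith)
    have e₂ : lowerLevel g (-H + c) = ∅ := lowerLevel_eq_empty hg (by linarith)
    simp only [dualRank, boxCount, e₁, e₂, componentCount_empty]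
    constructor <;> intro _
    · have := componentCount_sub_le (A₁ := lowerLevel f (-y)) (A₂ := lowerLevel g (-y + c))
        (lowerLevel_subset hfg₁ le_rfl) (hgmono (by linarith : -y ≤ -x₂))
        (hgmono (by linarith : -x₂ ≤ -x₁))
        (finite_components_lowerLevel hgg (by linarith))
        (finite_components_lowerLevel hgg (by linarith))
      linarith
    · have := componentCount_sub_le (A₁ := lowerLevel g (-(y + 2 * c) + c))
        (A₂ := lowerLevel f (-y)) (B₁ := lowerLevel g (-x₂ + c))
        (lowerLevel_subset hfg₂ (by linarith)) (lowerLevel_subset hfg₁ (by linarith))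
        (hgmono (by linarith : -x₂ ≤ -x₁))
        (finite_components_lowerLevel hfg₁ (by linarith))
        (finite_components_lowerLevel hfg₁ (by linarith))
      linarith

theorem isSizeRank_sizeFunction [ConnectedSpace X] {f : C(X, ℝ)} {B R : ℝ}
    (hf : ∀ p, |f p| ≤ B) (hR : B < R)
    {p₀ : X} (hp₀ : ∀ p, f p₀ ≤ f p) : IsSizeRank (f p₀) R (sizeFunction f) := by
  have hff : ∀ p, f p ≤ f p + 0 := fun p => (add_zero _).ge
  have hne : ∀ {x}, f p₀ ≤ x → (lowerLevel f x).Nonempty := fun {x} hx => ⟨p₀, hx⟩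
  have hfin : ∀ {x y}, x < y →
      (connectedComponentIn (lowerLevel f y) '' lowerLevel f x).Finite := fun {x y} h =>
    finite_components_lowerLevel hff (by linarith)
  constructor
  · simp only [sizeFunction_eq_componentCount]
    exact isRankFunction_componentCount (monotone_lowerLevel f) (monotone_lowerLevel f)
      (fun h => monotone_lowerLevel f h.le) hfin (fun h => lowerLevel_eq_empty hf (by linarith))
      fun h => lowerLevel_eq_univ hf (by linarith)
  · intro x₁ x₂ y h₁ h₂
    simp only [sizeFunction_eq_componentCount]
    exact componentCount_mono (monotone_lowerLevel f h₁) (hfin h₂)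
  · intro x y h
    have e : lowerLevel f x = ∅ :=
      eq_empty_of_forall_notMem fun p hp => (h.trans_le (hp₀ p)).not_ge hp
    rw [sizeFunction_eq_componentCount, e, componentCount_empty]
  · intro x y h₁ h₂
    rw [sizeFunction_eq_componentCount, lowerLevel_eq_univ hf (hR.le.trans h₂),
      componentCount_univ (hne h₁)]
  · intro x y h₁ h₂
    rw [sizeFunction_eq_componentCount]
    exact (ncard_pos (hfin h₂)).2 ((hne h₁).image _)

end Levels

/-! ### Representative sequences -/

namespace ExtendedHalfPlane

/-- The coordinates of a point; a point at infinity is sent to the diagonal. -/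
def coords : ExtendedHalfPlane → ℝ × ℝ
  | point x y _ => (x, y)
  | atInfinity k => (k, k)

theorem eq_point_iff_coords {P : ExtendedHalfPlane} {x y : ℝ} (h : x < y) :
    P = point x y h.le ↔ P.coords = (x, y) := by
  cases P with
  | point x' y' h' => simp [coords]
  | atInfinity k =>
    simp only [coords, reduceCtorEq, Prod.mk.injEq, false_iff, not_and]
    rintro rfl rfl
    exact h.false

theorem dist_comm (P Q : ExtendedHalfPlane) : P.dist Q = Q.dist P := by
  cases P <;> cases Q <;> simp only [dist]
  · rw [abs_sub_comm, abs_sub_comm (_ : ℝ) (_ : ℝ), max_comm ((_ - _) / 2)]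
    congr 3
    exact abs_sub_comm _ _
  · rw [abs_sub_comm]

theorem dist_le_of_coords {P Q : ExtendedHalfPlane} {c : ℝ} (hP : P.coords.1 < P.coords.2)
    (hQ : Q.coords.1 < Q.coords.2) (h₁ : |P.coords.1 - Q.coords.1| ≤ c)
    (h₂ : |P.coords.2 - Q.coords.2| ≤ c) : P.dist Q ≤ ENNReal.ofReal c := by
  cases P with
  | atInfinity k => exact absurd hP (lt_irrefl _)
  | point x y h =>
    cases Q with
    | atInfinity k => exact absurd hQ (lt_irrefl _)
    | point x' y' h' => exact ENNReal.ofReal_le_ofReal ((min_le_left _ _).trans (max_le h₁ h₂))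

/-- The second term of the minimum ignores the position on the diagonal, so any diagonal point
serves as partner. -/
theorem dist_diagonal_le {x y z c : ℝ} (h : x ≤ y) (hc : 0 ≤ c) (hxy : y ≤ x + 2 * c) :
    (point x y h).dist (point z z le_rfl) ≤ ENNReal.ofReal c := by
  refine ENNReal.ofReal_le_ofReal ((min_le_right _ _).trans (max_le ?_ ?_)) <;> linarith

end ExtendedHalfPlane

open ExtendedHalfPlane

theorem pointMultiplicity_eq_multiplicity (ℓ : ℝ → ℝ → ℕ) (x y : ℝ) :
    pointMultiplicity ℓ x y = multiplicity (fun x y => (ℓ x y : ℤ)) x y := by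
  unfold multiplicity pointMultiplicity boxCount
  congr 1
  ext m
  constructor
  · rintro ⟨ε, h₁, h₂, rfl⟩
    exact ⟨ε, ⟨h₁, by linarith⟩, rfl⟩
  · rintro ⟨ε, ⟨h₁, h₂⟩, rfl⟩
    exact ⟨ε, h₁, by linarith, rfl⟩

/-- Restricting to strictly increasing coordinates discards the diagonal terms and the point at
infinity. Where the multiplicity is zero, `count` says nothing and `pos` shows that the fibre is
empty. -/
theorem IsRepresentativeSequence.enumerates {ℓ : ℝ → ℝ → ℕ} {R : ℝ} {a : ℕ → ExtendedHalfPlane}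
    (ha : IsRepresentativeSequence ℓ a) (hℓ : IsRankFunction R fun x y => (ℓ x y : ℤ)) :
    Enumerates (fun x y => (ℓ x y : ℤ))
      fun n : {n // (a n).coords.1 < (a n).coords.2} => (a n).coords := by
  have himage : ∀ b d : ℝ, b < d → Subtype.val '' {n : {n // (a n).coords.1 < (a n).coords.2} |
      (a n).coords = (b, d)} = {n | (a n).coords = (b, d)} := by
    intro b d h
    ext n
    constructor
    · rintro ⟨m, hm, rfl⟩
      exact hm
    · intro hn
      have hn' : (a n).coords = (b, d) := hn
      exact ⟨⟨n, by rw [hn']; exact h⟩, hn, rfl⟩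
  have hmult := pointMultiplicity_eq_multiplicity ℓ
  have key : ∀ b d, b < d → {n | (a n).coords = (b, d)}.Finite ∧
      ({n | (a n).coords = (b, d)}.ncard : ℤ) = multiplicity (fun x y => (ℓ x y : ℤ)) b d := by
    intro b d h
    rcases (hℓ.multiplicity_nonneg h).eq_or_lt with h₀ | h₀
    · have e : {n | (a n).coords = (b, d)} = ∅ := by
        refine eq_empty_of_forall_notMem fun n hn => ?_
        have hn' := (eq_point_iff_coords h).2 hn
        rcases Nat.eq_zero_or_pos n with rfl | hpos
        · obtain ⟨k, hk, -⟩ := ha.zero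
          rw [hk] at hn'
          cases hn'
        · obtain ⟨x, y, hxy, e, h₁⟩ := ha.pos n hpos
          rw [hn'] at e
          obtain ⟨rfl, rfl⟩ := point.inj e
          rcases h₁ with h₁ | h₁
          · exact h.ne h₁
          · rw [hmult] at h₁
            exact h₁.2.ne h₀
      rw [e, ← h₀]
      simp
    · rw [← hmult] at h₀ ⊢
      have e := ha.count b d h h₀
      simp only [eq_point_iff_coords h] at e
      refine ⟨finite_of_ncard_pos ?_, e⟩
      omega
  refine ⟨fun n => n.2, fun b d h => ?_, fun b d h => ?_⟩
  · refine Set.Finite.of_finite_image ?_ Subtype.val_injective.injOn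
    rw [himage b d h]
    exact (key b d h).1
  · rw [← (key b d h).2, ← himage b d h, ncard_image_of_injective _ Subtype.val_injective]

namespace IsSizeRank

variable {k R : ℝ} {ℓ : ℝ → ℝ → ℕ}

theorem multiplicityAtInfinity_pos (h : IsSizeRank k R ℓ) : 0 < multiplicityAtInfinity ℓ k := by
  -- Nonemptiness matters: the infimum of the empty set of integers is `0`.
  have hne : {m : ℤ | ∃ ε : ℝ, 0 < ε ∧ k + ε < 1 / ε ∧
      m = (ℓ (k + ε) (1 / ε) : ℤ) - ℓ (k - ε) (1 / ε)}.Nonempty := by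
    refine ⟨_, 1 / (|k| + 2), by positivity, ?_, rfl⟩
    rw [one_div_one_div]
    have h₁ : 1 / (|k| + 2) ≤ 1 := by
      rw [div_le_one (by positivity)]
      linarith [abs_nonneg k]
    linarith [le_abs_self k]
  refine (zero_lt_one (α := ℤ)).trans_le (le_csInf hne ?_)
  rintro _ ⟨ε, h₁, h₂, rfl⟩
  have e₁ := h.pos (x := k + ε) (by linarith) h₂
  have e₂ := h.zero (x := k - ε) (y := 1 / ε) (by linarith)
  omega

theorem eq_of_multiplicityAtInfinity_pos (h : IsSizeRank k R ℓ) {k' : ℝ}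
    (hk' : 0 < multiplicityAtInfinity ℓ k') : k' = k := by
  by_contra hne
  obtain ⟨ε, h₁, h₂, h₃, h₄⟩ : ∃ ε, 0 < ε ∧ k' + ε < 1 / ε ∧ R ≤ 1 / ε ∧
      (ℓ (k' + ε) (1 / ε) : ℤ) - ℓ (k' - ε) (1 / ε) = 0 := by
    have hd : 0 < |k' - k| := abs_pos.2 (sub_ne_zero.2 hne)
    -- With ε = 1 / A the interval around `k'` misses `k` and the level `A` exceeds `R`, so both
    -- counts are `0` (left of `k`) or both are `1` (right of `k`).
    set A := |k'| + |R| + 2 / |k' - k| + 2 with hA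
    have hAp : 0 < A := by positivity
    have h₂ : 1 / A ≤ 1 := by
      rw [div_le_one hAp]
      have : 0 < 2 / |k' - k| := by positivity
      linarith [abs_nonneg k', abs_nonneg R]
    have h₃ : 1 / A < |k' - k| := by
      rw [div_lt_iff₀ hAp, hA]
      have e : |k' - k| * (2 / |k' - k|) = 2 := by field_simp
      nlinarith [mul_nonneg hd.le (abs_nonneg k'), mul_nonneg hd.le (abs_nonneg R)]
    have hR : R ≤ A := by
      have : 0 < 2 / |k' - k| := by positivity
      linarith [abs_nonneg k', le_abs_self R]
    refine ⟨1 / A, by positivity, ?_, ?_, ?_⟩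
    · rw [one_div_one_div]
      have : 0 < 2 / |k' - k| := by positivity
      linarith [abs_nonneg R, le_abs_self k']
    · rw [one_div_one_div]
      exact hR
    · rw [one_div_one_div]
      have hpos : 0 < 1 / A := by positivity
      rcases lt_or_gt_of_ne hne with hlt | hgt
      · rw [abs_of_neg (sub_neg.2 hlt)] at h₃
        rw [h.zero (by linarith), h.zero (by linarith), sub_self]
      · rw [abs_of_pos (sub_pos.2 hgt)] at h₃
        rw [h.one (by linarith) hR, h.one (by linarith) hR, sub_self]
  refine hk'.not_ge (csInf_le ⟨0, ?_⟩ ⟨ε, h₁, h₂, h₄.symm⟩)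
  rintro _ ⟨t, h₁, h₂, rfl⟩
  have := h.mono (x₁ := k' - t) (x₂ := k' + t) (by linarith) h₂
  omega

theorem exists_isRepresentativeSequence (h : IsSizeRank k R ℓ) :
    ∃ a, IsRepresentativeSequence ℓ a := by
  have := h.isRankFunction.countable_rankPoint
  set r : ℝ → ℝ → ℤ := fun x y => (ℓ x y : ℤ)
  have hr : IsRankFunction R r := h.isRankFunction
  -- The summand `ℕ` supplies the infinitely many diagonal terms; index `0` is then reserved for the
  -- point at infinity by a shift.
  have : Infinite (RankPoint R r ⊕ ℕ) := Sum.infinite_of_right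
  obtain ⟨e⟩ : Nonempty (ℕ ≃ RankPoint R r ⊕ ℕ) :=
    (nonempty_equiv_of_countable (α := ℕ) (β := RankPoint R r ⊕ ℕ))
  set P : RankPoint R r ⊕ ℕ → ExtendedHalfPlane :=
    Sum.elim (fun t => point t.birth t.death t.isDeath.1.le) fun _ => point 0 0 le_rfl with hP
  have hmult : ∀ b d, pointMultiplicity ℓ b d = multiplicity r b d :=
    pointMultiplicity_eq_multiplicity ℓ
  refine ⟨fun n => n.casesOn (atInfinity k) fun m => P (e m),
    ⟨k, rfl, h.multiplicityAtInfinity_pos⟩, ?_, ?_, ?_⟩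
  · rintro (_ | n) hn
    · exact absurd hn (lt_irrefl _)
    · change ∃ (x y : ℝ) (h : x ≤ y), P (e n) = point x y h ∧ _
      rcases e n with t | m
      · refine ⟨t.birth, t.death, t.isDeath.1.le, rfl, Or.inr ⟨t.isDeath.1, ?_⟩⟩
        have h₁ := hr.enumerates.ncard _ _ t.isDeath.1
        have h₂ := (ncard_pos (hr.enumerates.finite _ _ t.isDeath.1)).2 ⟨t, rfl⟩
        rw [hmult]
        omega
      · exact ⟨0, 0, le_rfl, rfl, Or.inl rfl⟩
  · intro b d hbd _
    rw [hmult, ← hr.enumerates.ncard _ _ hbd]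
    have himage : {n : ℕ | (n.casesOn (atInfinity k) fun m => P (e m) : ExtendedHalfPlane) =
        point b d hbd.le} = (fun t => e.symm (Sum.inl t) + 1) ''
          {t : RankPoint R r | t.pos = (b, d)} := by
      ext n
      constructor
      · rcases n with _ | n
        · intro hn
          cases hn
        · intro hn
          change P (e n) = point b d hbd.le at hn
          rcases hen : e n with t | m
          · rw [hen] at hn
            obtain ⟨h₁, h₂⟩ := point.inj hn
            refine ⟨t, Prod.ext h₁ h₂, ?_⟩
            simp only [← hen, e.symm_apply_apply]
          · rw [hen] at hn
            obtain ⟨h₁, h₂⟩ := point.inj hn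
            exact absurd hbd (by rw [← h₁, ← h₂]; exact lt_irrefl _)
      · rintro ⟨t, ht, rfl⟩
        obtain ⟨rfl, rfl⟩ := Prod.mk.inj ht
        change P (e (e.symm (Sum.inl t))) = _
        rw [e.apply_symm_apply]
        rfl
    rw [himage, ncard_image_of_injective]
    intro t t' htt
    exact Sum.inl_injective (e.symm.injective (Nat.succ_injective htt))
  · refine infinite_of_injective_forall_mem (f := fun m => e.symm (Sum.inr m) + 1) ?_ fun m => ?_
    · intro m m' hmm
      exact Sum.inr_injective (e.symm.injective (Nat.succ_injective hmm))
    · refine ⟨0, ?_⟩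
      change P (e (e.symm (Sum.inr m))) = _
      rw [e.apply_symm_apply]
      rfl

end IsSizeRank

/-! ### Stability of the matching distance -/

/-- A matching of the proper cornerpoints of large persistence extends to an injection of
representative sequences. -/
theorem exists_injective_dist_le {ℓ₁ ℓ₂ : ℝ → ℝ → ℕ} {a b : ℕ → ExtendedHalfPlane} {c : ℝ}
    (hc : 0 ≤ c) (ha : IsRepresentativeSequence ℓ₁ a) (hb : IsRepresentativeSequence ℓ₂ b)
    (h₀ : (a 0).dist (b 0) ≤ ENNReal.ofReal c)
    (hmatch : ∃ F : {i : {n // (a n).coords.1 < (a n).coords.2} //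
        (a i).coords.1 + 2 * c < (a i).coords.2} → {n // (b n).coords.1 < (b n).coords.2},
      Function.Injective F ∧ ∀ i, |(a i.1).coords.1 - (b (F i)).coords.1| ≤ c ∧
        |(a i.1).coords.2 - (b (F i)).coords.2| ≤ c) :
    ∃ f : ℕ → ℕ, Function.Injective f ∧ ∀ n, (a n).dist (b (f n)) ≤ ENNReal.ofReal c := by
  classical
  obtain ⟨F, hF, hFc⟩ := hmatch
  have := hb.diagonal.to_subtype
  set D : ℕ → ℕ := fun n => Infinite.natEmbedding {n | ∃ x, b n = point x x le_rfl} n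
  have hD : Function.Injective D :=
    Subtype.val_injective.comp (Infinite.natEmbedding _).injective
  have hDb : ∀ n, ∃ x, b (D n) = point x x le_rfl := fun n =>
    (Infinite.natEmbedding {n | ∃ x, b n = point x x le_rfl} n).2
  obtain ⟨k, hk, -⟩ := hb.zero
  have hD₀ : ∀ n, D n ≠ 0 := fun n hn => by
    obtain ⟨x, hx⟩ := hDb n
    rw [hn, hk] at hx
    cases hx
  have hDF : ∀ n i, D n ≠ (F i : ℕ) := fun n i hn => by
    obtain ⟨x, hx⟩ := hDb n
    have := (F i).2
    rw [← hn, hx] at this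
    exact lt_irrefl _ this
  have hF₀ : ∀ i, (F i : ℕ) ≠ 0 := fun i hi => by
    have := (F i).2
    rw [hi, hk] at this
    exact lt_irrefl _ this
  set S : ℕ → Prop := fun n =>
    (a n).coords.1 < (a n).coords.2 ∧ (a n).coords.1 + 2 * c < (a n).coords.2
  -- The three branches have disjoint ranges: `0`, indices of points strictly above the diagonal,
  -- and indices of diagonal points.
  refine ⟨fun n => if n = 0 then 0 else if h : S n then F ⟨⟨n, h.1⟩, h.2⟩ else D n, ?_, ?_⟩
  · intro m n hmn
    by_cases hm : m = 0 <;> by_cases hn : n = 0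
    · rw [hm, hn]
    · by_cases hn' : S n
      · simp only [hm, hn, hn', if_true, if_false, dite_true] at hmn
        exact absurd hmn.symm (hF₀ _)
      · simp only [hm, hn, hn', if_true, if_false, dite_false] at hmn
        exact absurd hmn.symm (hD₀ _)
    · by_cases hm' : S m
      · simp only [hm, hn, hm', if_true, if_false, dite_true] at hmn
        exact absurd hmn (hF₀ _)
      · simp only [hm, hn, hm', if_true, if_false, dite_false] at hmn
        exact absurd hmn (hD₀ _)
    · by_cases hm' : S m <;> by_cases hn' : S n <;>
        simp only [hm, hn, hm', hn', if_false, dite_true, dite_false] at hmn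
      · exact congrArg (fun i => (i.1.1 : ℕ)) (hF (Subtype.val_injective hmn))
      · exact absurd hmn.symm (hDF _ _)
      · exact absurd hmn (hDF _ _)
      · exact hD hmn
  · intro n
    by_cases hn : n = 0
    · simp only [hn, if_true]
      exact h₀
    · by_cases hS : S n
      · simp only [hn, hS, if_false, dite_true]
        exact dist_le_of_coords hS.1 (F ⟨⟨n, hS.1⟩, hS.2⟩).2 (hFc ⟨⟨n, hS.1⟩, hS.2⟩).1
          (hFc ⟨⟨n, hS.1⟩, hS.2⟩).2
      · simp only [hn, hS, if_false, dite_false]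
        obtain ⟨x, y, hxy, e, -⟩ := ha.pos n (Nat.pos_of_ne_zero hn)
        obtain ⟨z, hz⟩ := hDb n
        rw [e, hz]
        refine dist_diagonal_le hxy hc ?_
        by_contra! hlt
        refine hS ?_
        simp only [S, e, coords]
        exact ⟨by linarith, hlt⟩

/-- The matching stability theorem. -/
theorem matchingDistance_le {X : Type*} [TopologicalSpace X] [CompactSpace X] [ConnectedSpace X]
    [LocallyConnectedSpace X] {f g : C(X, ℝ)} {c : ℝ} (hfg : ∀ p, |f p - g p| ≤ c) :
    matchingDistance (sizeFunction f) (sizeFunction g) ≤ ENNReal.ofReal c := by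
  have key : ∀ u : C(X, ℝ), ∃ p₀ R, (∀ p, u p₀ ≤ u p) ∧ IsSizeRank (u p₀) R (sizeFunction u) := by
    intro u
    obtain ⟨B, hB⟩ := isCompact_univ.exists_bound_of_continuousOn u.continuous.continuousOn
    obtain ⟨p₀, -, hp₀⟩ := isCompact_univ.exists_isMinOn univ_nonempty u.continuous.continuousOn
    have hp₀' : ∀ p, u p₀ ≤ u p := fun p => hp₀ (mem_univ p)
    exact ⟨p₀, B + 1, hp₀', isSizeRank_sizeFunction (fun p => hB p (mem_univ p))
      (lt_add_one B) hp₀'⟩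
  obtain ⟨p, Rf, hp, hf⟩ := key f
  obtain ⟨q, Rg, hq, hg⟩ := key g
  have hc : 0 ≤ c := (abs_nonneg _).trans (hfg p)
  have hgf : ∀ p, |g p - f p| ≤ c := fun p => by rw [abs_sub_comm]; exact hfg p
  rw [matchingDistance, if_pos ⟨hf.exists_isRepresentativeSequence,
    hg.exists_isRepresentativeSequence⟩]
  refine iSup₂_le fun a ha => iSup₂_le fun b hb => ?_
  -- The cornerpoints at infinity are the minima of `f` and `g`, which differ by at most `c`.
  have h₀ : (a 0).dist (b 0) ≤ ENNReal.ofReal c := by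
    obtain ⟨k, hk, hk'⟩ := ha.zero
    obtain ⟨k', hk₁, hk₁'⟩ := hb.zero
    obtain rfl := hf.eq_of_multiplicityAtInfinity_pos hk'
    obtain rfl := hg.eq_of_multiplicityAtInfinity_pos hk₁'
    rw [hk, hk₁]
    refine ENNReal.ofReal_le_ofReal (abs_le.2 ⟨?_, ?_⟩)
    · linarith [hq p, (abs_le.1 (hfg p)).1]
    · linarith [hp q, (abs_le.1 (hfg q)).2]
  have ea := ha.enumerates hf.isRankFunction
  have eb := hb.enumerates hg.isRankFunction
  obtain ⟨F, hF, hF'⟩ := exists_injective_dist_le hc ha hb h₀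
    (exists_matching_sizeFunction hc hfg ea eb)
  obtain ⟨G, hG, hG'⟩ := exists_injective_dist_le hc hb ha (by rw [dist_comm]; exact h₀)
    (exists_matching_sizeFunction hc hgf eb ea)
  -- The bijection agrees at each index with `F` or with an inverse of `G`, so the distance bound
  -- survives.
  obtain ⟨σ, hσ, hσ'⟩ := Function.Embedding.schroeder_bernstein_of_rel hF hG
    (fun m n => (a m).dist (b n) ≤ ENNReal.ofReal c) hF' fun n => by rw [dist_comm]; exact hG' n
  exact iInf_le_of_le (Equiv.ofBijective σ hσ) (iSup_le hσ')

theorem abs_sub_le_oscillation {X : Type*} [TopologicalSpace X] [CompactSpace X] (ξ : C(X, ℝ))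
    (p q : X) : |ξ p - ξ q| ≤ oscillation ξ := by
  have hK : IsCompact (range ξ) := isCompact_range ξ.continuous
  have h₁ : ∀ p, ξ p ≤ ⨆ p, ξ p := fun p => le_ciSup hK.bddAbove p
  have h₂ : ∀ p, ⨅ p, ξ p ≤ ξ p := fun p => ciInf_le hK.bddBelow p
  unfold oscillation
  rw [abs_le]
  constructor <;> linarith [h₁ p, h₁ q, h₂ p, h₂ q]

end SizeTheory

theorem mainTheorem1 {M N : Type*}
    [TopologicalSpace M] [CompactSpace M] [T2Space M] [ConnectedSpace M] [LocallyConnectedSpace M]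
    [TopologicalSpace N] [CompactSpace N] [T2Space N] [ConnectedSpace N] [LocallyConnectedSpace N]
    (φ : C(M, ℝ)) (ψ : C(N, ℝ)) (hMN : Nonempty (M ≃ₜ N)) :
    SizeTheory.matchingDistance
        (SizeTheory.sizeFunction (SizeTheory.differenceFunction φ))
        (SizeTheory.sizeFunction (SizeTheory.differenceFunction ψ))
      ≤ SizeTheory.deltaLambda φ ψ := by
  refine le_iInf fun h => ?_
  -- Both measuring functions are brought to the same space `M × M`.
  rw [← SizeTheory.sizeFunction_comp_homeomorph (h.prodCongr h)]
  refine SizeTheory.matchingDistance_le fun p => ?_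
  have e : SizeTheory.differenceFunction φ p -
      (SizeTheory.differenceFunction ψ).comp (h.prodCongr h : C(M × M, N × N)) p =
      (φ - ψ.comp (h : C(M, N))) p.1 - (φ - ψ.comp (h : C(M, N))) p.2 := by
    change φ p.1 - φ p.2 - (ψ (h p.1) - ψ (h p.2)) = φ p.1 - ψ (h p.1) - (φ p.2 - ψ (h p.2))
    ring
  rw [e]
  exact SizeTheory.abs_sub_le_oscillation _ _ _
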